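/- Notation. For an integer $M\ge 1$, a vector $g\in\mathbb{C}^M$ is viewed as a function on $\mathbb{Z}_M$, and for $(k,\ell)\in\mathbb{Z}_M\times\mathbb{Z}_M$ put $(\pi(k,\ell)g)(j)=e^{2\pi i\ell j/M}g(j-k)$, $j\in\mathbb{Z}_M$. For $\Lambda\subset\mathbb{Z}_M\times\mathbb{Z}_M$ let $\Phi_\Lambda$ be the $M\times|\Lambda|$ matrix with columns $\pi(k,\ell)g$, $(k,\ell)\in\Lambda$, and let $\Phi_\Lambda^*$ be its adjoint, the analysis matrix of the Gabor system $(g,\Lambda)$. Write $\sigma_{\max}(\Phi_\Lambda^*)=\max_{\|x\|_2=1}\|\Phi_\Lambda^*x\|_2$ and $\sigma_{\min}(\Phi_\Lambda^*)=\min_{\|x\|_2=1}\|\Phi_\Lambda^*x\|_2$, $x\in\mathbb{C}^M$, for its extreme singular values. A Steinhaus window is a random vector $g(j)=\frac{1}{\sqrt M}e^{2\pi i y_j}$, $j\in\mathbb{Z}_M$, with $y_j$ independent and uniformly distributed on $[0,1)$. Theorem. For every even $m\ge 2$ there are constants $C_0,K,a>0$ depending only on $m$ such that the following holds. For all $C\ge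 C_0$ and $\delta>0$ there is $\varepsilon\in(0,1)$, depending only on $m$, $\delta$ and $C$, with $\varepsilon\le K/(C\delta)^m$, and there is $M_0=M_0(m,\delta,C)$ such that, for all $M\ge M_0$: if $g$ is a Steinhaus window in $\mathbb{C}^M$ and $\Lambda\subset\mathbb{Z}_M\times\mathbb{Z}_M$ is a random set, chosen independently of $g$, for which the events $\{(k,\ell)\in\Lambda\}$, $(k,\ell)\in\mathbb{Z}_M\times\mathbb{Z}_M$, are independent and each have probability $\tau=\frac{C\log M}{M^{(m-1)/m}}$, then, with probability at least $1-M^{-a}$ with respect to the choice of $\Lambda$, $$\mathbb{P}_g\left\{\frac{|\Lambda|}{M}(1-\delta)\le\sigma_{\min}^2(\Phi_\Lambda^*)\le\sigma_{\max}^2(\Phi_\Lambda^*)\le\frac{|\Lambda|}{M}(1+\delta)\right\}\ge 1-\varepsilon,$$ where $\mathbb{P}_g$ is the probability with respect to $g$ for fixed $\Lambda$. -/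

import Mathlib

open MeasureTheory ProbabilityTheory

noncomputable section

/-- Cyclic translation `(T_k x)(j) = x (j - k)` of a vector indexed by `ℤ/M`. -/
def gaborTranslation {M : ℕ} (k : ZMod M) (x : ZMod M → ℂ) : ZMod M → ℂ :=
  fun j => x (j - k)

/-- Modulation `(M_ℓ x)(j) = exp (2 π i ℓ j / M) x(j)`; here `ZMod.stdAddChar` is the character
`j ↦ exp (2 π i j / M)` of `ℤ/M`. -/
def gaborModulation {M : ℕ} [NeZero M] (l : ZMod M) (x : ZMod M → ℂ) : ZMod M → ℂ :=
  fun j => ZMod.stdAddChar (l * j) * x j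

/-- The time-frequency shift `π(k, ℓ) = M_ℓ T_k`. -/
def timeFreqShift {M : ℕ} [NeZero M] (p : ZMod M × ZMod M) (x : ZMod M → ℂ) : ZMod M → ℂ :=
  gaborModulation p.2 (gaborTranslation p.1 x)

/-- The synthesis matrix `Φ_Λ` of the Gabor system `(g, Λ)`: its columns are the vectors
`π(k, ℓ) g`, `(k, ℓ) ∈ Λ`. -/
def gaborSynthesis {M : ℕ} [NeZero M] (g : ZMod M → ℂ) (S : Finset (ZMod M × ZMod M)) :
    Matrix (ZMod M) S ℂ :=
  Matrix.of fun j p => timeFreqShift p.1 g j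

/-- The analysis matrix `Φ_Λ^*` of the Gabor system `(g, Λ)`. -/
def gaborAnalysis {M : ℕ} [NeZero M] (g : ZMod M → ℂ) (S : Finset (ZMod M × ZMod M)) :
    Matrix S (ZMod M) ℂ :=
  (gaborSynthesis g S).conjTranspose

/-- The largest singular value of a matrix, acting between Euclidean spaces. -/
def sigmaMax {m n : Type*} [Fintype m] [Fintype n] [DecidableEq n] (A : Matrix m n ℂ) : ℝ :=
  (Matrix.toEuclideanLin A).singularValues 0

/-- The smallest singular value of a matrix `A` with `N` columns, that is, the `N`-th largest one:
the square root of the smallest eigenvalue of `Aᴴ A`, or the minimum of `‖A x‖` over unit vectors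
`x`. (Mathlib numbers the singular values in decreasing order, starting from `0`.) -/
def sigmaMin {m n : Type*} [Fintype m] [Fintype n] [DecidableEq n] (A : Matrix m n ℂ) : ℝ :=
  (Matrix.toEuclideanLin A).singularValues (Fintype.card n - 1)

/-- `g` is a Steinhaus random vector: `g(j) = M^{-1/2} exp (2 π i y_j)` with `y_j`, `j ∈ ℤ/M`,
independent and uniformly distributed on `[0, 1)`. -/
def IsSteinhaus {M : ℕ} {Ω : Type*} [MeasurableSpace Ω] (g : Ω → ZMod M → ℂ)
    (P : Measure Ω) : Prop :=
  ∃ y : ZMod M → Ω → ℝ,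
    (∀ j, Measurable (y j)) ∧
    iIndepFun y P ∧
    (∀ j, pdf.IsUniform (y j) (Set.Ico 0 1) P) ∧
    ∀ ω j, g ω j = (1 / Real.sqrt M : ℝ) * Complex.exp (2 * Real.pi * Complex.I * (y j ω : ℂ))

/-- `L` is a random subset of `ι` for which the events `{i ∈ L}`, `i ∈ ι`, are independent and each
has probability `t`. -/
def IsBernoulliSubset {ι Ω : Type*} [MeasurableSpace Ω] (L : Ω → Finset ι) (P : Measure Ω)
    (t : ℝ) : Prop :=
  (∀ i, MeasurableSet {ω | i ∈ L ω}) ∧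
  iIndepSet (fun i => {ω | i ∈ L ω}) P ∧
  ∀ i, P.real {ω | i ∈ L ω} = t

/-- The inclusion probability `C log M / M^{(m-1)/m}`. -/
def inclusionProb (m M : ℕ) (C : ℝ) : ℝ :=
  C * Real.log M / (M : ℝ) ^ (((m : ℝ) - 1) / m)

/-- The event that `(|S|/M)(1-δ) ≤ σ_min²(Φ_S^*) ≤ σ_max²(Φ_S^*) ≤ (|S|/M)(1+δ)`, for a fixed index
set `S` and a random window `g`. -/
def wellConditionedEvent {M : ℕ} [NeZero M] {Ω : Type*} (g : Ω → ZMod M → ℂ)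
    (S : Finset (ZMod M × ZMod M)) (δ : ℝ) : Set Ω :=
  {ω | (S.card : ℝ) / M * (1 - δ) ≤ sigmaMin (gaborAnalysis (g ω) S) ^ 2 ∧
    sigmaMin (gaborAnalysis (g ω) S) ^ 2 ≤ sigmaMax (gaborAnalysis (g ω) S) ^ 2 ∧
    sigmaMax (gaborAnalysis (g ω) S) ^ 2 ≤ (S.card : ℝ) / M * (1 + δ)}

end

/-! The full Gabor system of a unit window is a tight frame of unit vectors `v i` with bound `D =
M`. For each fixed window, let `H` be the frame operator of a Bernoulli subfamily minus its mean `p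
* D`. The claim reduces to bounding the even trace moments E tr H^(2k), averaged over the subset, by
a constant times M (pD)^k.

The bound is an induction on k. Write tr H^(2k+2) as the sum over i of (1_{i ∈ S} - p) ⟨v i,
H^(2k+1) v i⟩. The first factor is centred and independent of the other memberships, so only the
change of the second under flipping i survives. That is a rank-one perturbation, controlled by ⟨v i,
H^(2k) v i⟩ before and after the flip (`re_trace_vecMulVec_mul_pow_sub_le`). Tightness sums these
terms back to moments of orders 2k+1 and 2k, and Young's inequality absorbs the odd one.

A small moment confines all squared singular values, and |S|/M as well, to a narrow interval around
pM (`wellConditioned_of_re_trace_le`). Fubini and two uses of Markov's inequality convert the moment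
bound into the nested probabilities (`wellConditioned_probability_bound`). -/

/-! ### Weighted sums over Bernoulli subsets -/

/-- The probability that a Bernoulli random subset with inclusion probability `p` equals `S`. -/
noncomputable def bernoulliWeight {ι : Type*} [Fintype ι] [DecidableEq ι] (p : ℝ)
    (S : Finset ι) : ℝ :=
  ∏ i, if i ∈ S then p else 1 - p

section BernoulliWeight

variable {ι : Type*} [Fintype ι] [DecidableEq ι]

lemma bernoulliWeight_nonneg {p : ℝ} (hp0 : 0 ≤ p) (hp1 : p ≤ 1) (S : Finset ι) :
    0 ≤ bernoulliWeight p S := by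
  refine Finset.prod_nonneg fun i _ => ?_
  split_ifs <;> linarith

/-- Conditioning on all memberships except that of `i`: `u` is the product weight over the other
indices. -/
lemma exists_sum_bernoulliWeight_eq {p : ℝ} (hp0 : 0 ≤ p) (hp1 : p ≤ 1) (i : ι) :
    ∃ u : Finset ι → ℝ, (∀ S, 0 ≤ u S) ∧ ∀ f : Finset ι → ℝ,
      ∑ S, bernoulliWeight p S * f S =
        ∑ S ∈ (Finset.univ.erase i).powerset, u S * (p * f (insert i S) + (1 - p) * f S) := by
  refine ⟨fun S => ∏ j ∈ Finset.univ.erase i, if j ∈ S then p else 1 - p, fun S => ?_,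
    fun f => ?_⟩
  · refine Finset.prod_nonneg fun i _ => ?_
    split_ifs <;> linarith
  · have h1 : (Finset.univ : Finset (Finset ι)) =
        (insert i (Finset.univ.erase i) : Finset ι).powerset := by
      rw [Finset.insert_erase (Finset.mem_univ i), Finset.powerset_univ]
    rw [h1, Finset.sum_powerset_insert (Finset.notMem_erase i _), ← Finset.sum_add_distrib]
    refine Finset.sum_congr rfl fun S hS => ?_
    have hi : i ∉ S := fun h => Finset.notMem_erase i _ (Finset.mem_powerset.1 hS h)
    have h2 : ∀ T : Finset ι, bernoulliWeight p T = (if i ∈ T then p else 1 - p) *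
        ∏ j ∈ Finset.univ.erase i, if j ∈ T then p else 1 - p := fun T =>
      (Finset.mul_prod_erase _ _ (Finset.mem_univ i)).symm
    have h3 : (∏ j ∈ Finset.univ.erase i, if j ∈ insert i S then p else 1 - p) =
        ∏ j ∈ Finset.univ.erase i, if j ∈ S then p else 1 - p := by
      refine Finset.prod_congr rfl fun j hj => ?_
      simp [Finset.ne_of_mem_erase hj]
    rw [h2 S, h2 (insert i S), h3]
    simp only [hi, if_false, Finset.mem_insert_self, if_true]
    ring

/-- If flipping the membership of `i` changes `f` by at most `G S + G (insert i S)`, then the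
correlation of `f` with the membership of `i` is controlled by `G`. -/
lemma sum_bernoulliWeight_sub_mul_le {p : ℝ} (hp0 : 0 ≤ p) (hp1 : p ≤ 1) (i : ι)
    (f G : Finset ι → ℝ) (hfG : ∀ S, i ∉ S → f (insert i S) - f S ≤ G (insert i S) + G S)
    (hG : ∀ S, 0 ≤ G S) :
    ∑ S, bernoulliWeight p S * (((if i ∈ S then 1 else 0) - p) * f S) ≤
      ∑ S, bernoulliWeight p S * (((if i ∈ S then 1 else 0) + p) * G S) := by
  obtain ⟨u, hu, h⟩ := exists_sum_bernoulliWeight_eq hp0 hp1 i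
  rw [h, h]
  refine Finset.sum_le_sum fun S hS => mul_le_mul_of_nonneg_left ?_ (hu S)
  have hi : i ∉ S := fun h => Finset.notMem_erase i _ (Finset.mem_powerset.1 hS h)
  simp only [hi, if_false, Finset.mem_insert_self, if_true]
  -- The centred factor leaves p(1-p) times the flip difference. The right side carries p(1+p) on `G
  -- (insert i S)`; its surplus 2p² is discarded by `h2`.
  have h1 := mul_le_mul_of_nonneg_left (hfG S hi) (mul_nonneg hp0 (sub_nonneg.2 hp1))
  have h2 := mul_nonneg (mul_nonneg hp0 hp0) (hG (insert i S))
  nlinarith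

lemma sum_bernoulliWeight (p : ℝ) : ∑ S : Finset ι, bernoulliWeight p S = 1 := by
  have h := Finset.prod_add (fun _ : ι => p) (fun _ => 1 - p) Finset.univ
  simp only [add_sub_cancel, Finset.prod_const_one, Finset.powerset_univ] at h
  rw [h]
  refine Finset.sum_congr rfl fun S _ => ?_
  rw [bernoulliWeight, Finset.prod_ite]
  congr 2 <;> ext i <;> simp

end BernoulliWeight

/-! ### Power inequalities and telescoping -/

/-- Rearrangement: |x|^j - |y|^j and |x|^r - |y|^r have the same sign. -/
lemma pow_mul_pow_add_le (x y : ℝ) (k j : ℕ) (hj : j ≤ 2 * k) :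
    x ^ j * y ^ (2 * k - j) + x ^ (2 * k - j) * y ^ j ≤ x ^ (2 * k) + y ^ (2 * k) := by
  obtain ⟨r, hr⟩ := Nat.exists_eq_add_of_le hj
  have hr' : 2 * k - j = r := by omega
  rw [hr']
  have he : ∀ z : ℝ, z ^ (2 * k) = |z| ^ j * |z| ^ r := fun z => by
    rw [← pow_add, ← hr, pow_mul, pow_mul, sq_abs]
  have h1 : ∀ a b : ℕ, x ^ a * y ^ b ≤ |x| ^ a * |y| ^ b := fun a b => by
    rw [← abs_pow, ← abs_pow, ← abs_mul]; exact le_abs_self _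
  have h2 : 0 ≤ (|x| ^ j - |y| ^ j) * (|x| ^ r - |y| ^ r) := by
    rcases le_total |x| |y| with h | h
    · exact mul_nonneg_of_nonpos_of_nonpos
        (sub_nonpos.2 (pow_le_pow_left₀ (abs_nonneg _) h _))
        (sub_nonpos.2 (pow_le_pow_left₀ (abs_nonneg _) h _))
    · exact mul_nonneg
        (sub_nonneg.2 (pow_le_pow_left₀ (abs_nonneg _) h _))
        (sub_nonneg.2 (pow_le_pow_left₀ (abs_nonneg _) h _))
  rw [he x, he y]
  nlinarith [h1 j r, h1 r j]

lemma sum_pow_mul_pow_le (x y : ℝ) (k : ℕ) :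
    ∑ j ∈ Finset.range (2 * k + 1), x ^ j * y ^ (2 * k - j) ≤
      (2 * k + 1) / 2 * (x ^ (2 * k) + y ^ (2 * k)) := by
  have h := Finset.sum_range_reflect (fun j => x ^ j * y ^ (2 * k - j)) (2 * k + 1)
  have h1 : ∑ j ∈ Finset.range (2 * k + 1),
      (x ^ j * y ^ (2 * k - j) + x ^ (2 * k - j) * y ^ j) ≤
      ∑ _j ∈ Finset.range (2 * k + 1), (x ^ (2 * k) + y ^ (2 * k)) :=
    Finset.sum_le_sum fun j hj => pow_mul_pow_add_le x y k j (by grind)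
  have h2 : ∑ j ∈ Finset.range (2 * k + 1), x ^ (2 * k - j) * y ^ j =
      ∑ j ∈ Finset.range (2 * k + 1), x ^ j * y ^ (2 * k - j) := by
    rw [← h]
    refine Finset.sum_congr rfl fun j hj => ?_
    have : j ≤ 2 * k := by grind
    rw [show 2 * k + 1 - 1 - j = 2 * k - j by omega, show 2 * k - (2 * k - j) = j by omega]
  rw [Finset.sum_add_distrib, h2, Finset.sum_const, Finset.card_range, nsmul_eq_mul] at h1
  push_cast at h1
  linarith

lemma pow_sub_pow_eq_sum {R : Type*} [Ring R] (x y : R) (q : ℕ) :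
    x ^ q - y ^ q = ∑ j ∈ Finset.range q, x ^ j * (x - y) * y ^ (q - 1 - j) := by
  induction q with
  | zero => simp
  | succ q ih =>
    rw [Finset.sum_range_succ']
    have h : ∀ j ∈ Finset.range q, x ^ (j + 1) * (x - y) * y ^ (q + 1 - 1 - (j + 1)) =
        x * (x ^ j * (x - y) * y ^ (q - 1 - j)) := fun j _ => by
      rw [show q + 1 - 1 - (j + 1) = q - 1 - j by omega, pow_succ']
      simp only [mul_assoc]
    rw [Finset.sum_congr rfl h, ← Finset.mul_sum, ← ih, pow_succ', pow_succ']
    simp only [pow_zero, one_mul, Nat.add_sub_cancel, Nat.sub_zero]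
    noncomm_ring

/-! ### Trace moments of Hermitian matrices -/

section Hermitian

open Matrix

variable {n : Type*} [Fintype n]

lemma trace_vecMulVec_star_mul (v : n → ℂ) (X : Matrix n n ℂ) :
    (vecMulVec v (star v) * X).trace = star v ⬝ᵥ (X *ᵥ v) := by
  rw [vecMulVec_mul, trace_vecMulVec, dotProduct_mulVec, dotProduct_comm]

lemma trace_vecMulVec_star_mul_mul (v : n → ℂ) (X Y : Matrix n n ℂ) :
    (vecMulVec v (star v) * (X * vecMulVec v (star v) * Y)).trace =
      (star v ⬝ᵥ (X *ᵥ v)) * (star v ⬝ᵥ (Y *ᵥ v)) := by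
  rw [trace_vecMulVec_star_mul, ← mulVec_mulVec, ← mulVec_mulVec, vecMulVec_mulVec,
    mulVec_smul, dotProduct_smul]
  simp

variable [DecidableEq n]

lemma Matrix.IsHermitian.pow_eq {H : Matrix n n ℂ} (hH : H.IsHermitian) (j : ℕ) :
    H ^ j = (hH.eigenvectorUnitary : Matrix n n ℂ) *
      diagonal ((RCLike.ofReal ∘ hH.eigenvalues) ^ j) *
        star (hH.eigenvectorUnitary : Matrix n n ℂ) := by
  set U : Matrix n n ℂ := (hH.eigenvectorUnitary : Matrix n n ℂ) with hU
  set D : Matrix n n ℂ := diagonal (RCLike.ofReal ∘ hH.eigenvalues) with hD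
  have hUU : star U * U = 1 := Unitary.coe_star_mul_self hH.eigenvectorUnitary
  have hs : H = U * D * star U := by
    conv_lhs => rw [hH.spectral_theorem]
    rfl
  rw [← diagonal_pow, ← hD]
  induction j with
  | zero => simp [hU]
  | succ j ih =>
    rw [pow_succ, ih]
    conv_lhs => rw [hs]
    rw [show U * D ^ j * star U * (U * D * star U) = U * D ^ j * (star U * U) * D * star U by
      simp only [mul_assoc], hUU, pow_succ]
    simp only [mul_assoc, one_mul]

/-- The weights `c` form the spectral measure of `H` at `v`: squared moduli of the coordinates of
`v` in an eigenbasis. They serve all powers at once. -/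
lemma Matrix.IsHermitian.exists_pow_eq_sum {H : Matrix n n ℂ} (hH : H.IsHermitian) (v : n → ℂ) :
    ∃ c : n → ℝ, (∀ i, 0 ≤ c i) ∧ ∀ j : ℕ,
      star v ⬝ᵥ ((H ^ j) *ᵥ v) = ((∑ i, hH.eigenvalues i ^ j * c i : ℝ) : ℂ) := by
  set U : Matrix n n ℂ := (hH.eigenvectorUnitary : Matrix n n ℂ) with hU
  refine ⟨fun i => Complex.normSq ((star U *ᵥ v) i), fun i => Complex.normSq_nonneg _,
    fun j => ?_⟩
  rw [hH.pow_eq, ← hU, ← mulVec_mulVec, ← mulVec_mulVec, dotProduct_mulVec]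
  have h1 : star v ᵥ* U = star (star U *ᵥ v) := by
    rw [star_mulVec, star_eq_conjTranspose, conjTranspose_conjTranspose]
  rw [h1]
  simp only [dotProduct, mulVec_diagonal, Pi.star_apply, Complex.ofReal_sum]
  refine Finset.sum_congr rfl fun i _ => ?_
  rw [Complex.ofReal_mul, Complex.normSq_eq_conj_mul_self]
  simp
  ring

lemma Matrix.IsHermitian.re_trace_pow {H : Matrix n n ℂ} (hH : H.IsHermitian) (j : ℕ) :
    (H ^ j).trace.re = ∑ i, hH.eigenvalues i ^ j := by
  rw [hH.pow_eq, trace_mul_cycle, Unitary.coe_star_mul_self, one_mul, trace_diagonal,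
    Complex.re_sum]
  refine Finset.sum_congr rfl fun i _ => ?_
  rw [Pi.pow_apply, Function.comp_apply]
  exact_mod_cast Complex.ofReal_re _

lemma Matrix.IsHermitian.eigenvalues_pow_le {H : Matrix n n ℂ} (hH : H.IsHermitian) (k : ℕ)
    (i : n) : hH.eigenvalues i ^ (2 * k) ≤ (H ^ (2 * k)).trace.re := by
  rw [hH.re_trace_pow]
  exact Finset.single_le_sum (f := fun i => hH.eigenvalues i ^ (2 * k))
    (fun i _ => (even_two_mul k).pow_nonneg _) (Finset.mem_univ i)

lemma Matrix.IsHermitian.re_trace_pow_nonneg {H : Matrix n n ℂ} (hH : H.IsHermitian) (k : ℕ) :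
    0 ≤ (H ^ (2 * k)).trace.re := by
  rw [hH.re_trace_pow]
  exact Finset.sum_nonneg fun i _ => (even_two_mul k).pow_nonneg _

lemma Matrix.IsHermitian.abs_re_trace_le {H : Matrix n n ℂ} (hH : H.IsHermitian) {k : ℕ}
    (hk : k ≠ 0) {t : ℝ} (ht : 0 ≤ t) (h : (H ^ (2 * k)).trace.re ≤ t ^ (2 * k)) :
    |H.trace.re| ≤ Fintype.card n * t := by
  have h1 := hH.re_trace_pow 1
  simp only [pow_one] at h1
  rw [h1]
  refine (Finset.abs_sum_le_sum_abs _ _).trans ?_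
  rw [← nsmul_eq_mul]
  refine Finset.sum_le_card_nsmul _ _ _ fun i _ => ?_
  refine le_of_pow_le_pow_left₀ (n := 2 * k) (by omega) ht ?_
  rw [(even_two_mul k).pow_abs]
  exact (hH.eigenvalues_pow_le k i).trans h

open scoped ComplexOrder in
-- Averaging against the spectral measure of `w` avoids locating `s` in the list `eigenvalues`;
-- singular values will enter through eigenvectors.
lemma Matrix.IsHermitian.pow_le_re_trace_of_mulVec_eq {H : Matrix n n ℂ} (hH : H.IsHermitian)
    (k : ℕ) {s : ℝ} {w : n → ℂ} (hw : w ≠ 0) (hs : H *ᵥ w = (s : ℂ) • w) :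
    s ^ (2 * k) ≤ (H ^ (2 * k)).trace.re := by
  have hp : ∀ j : ℕ, (H ^ j) *ᵥ w = ((s ^ j : ℝ) : ℂ) • w := fun j => by
    induction j with
    | zero => simp
    | succ j ih =>
      rw [pow_succ', ← mulVec_mulVec, ih, mulVec_smul, hs, smul_smul, pow_succ]
      push_cast
      rfl
  obtain ⟨c, hc, hcs⟩ := hH.exists_pow_eq_sum w
  have h0 := hcs 0
  have h1 := hcs (2 * k)
  simp only [pow_zero, one_mulVec, one_mul] at h0
  rw [hp, dotProduct_smul, h0, smul_eq_mul, ← Complex.ofReal_mul] at h1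
  have h2 : s ^ (2 * k) * ∑ i, c i = ∑ i, hH.eigenvalues i ^ (2 * k) * c i := by
    exact_mod_cast h1
  have h3 : 0 < ∑ i, c i := by
    refine lt_of_le_of_ne (Finset.sum_nonneg fun i _ => hc i) fun h => hw ?_
    rw [← h, Complex.ofReal_zero] at h0
    exact dotProduct_star_self_eq_zero.1 h0
  refine le_of_mul_le_mul_right ?_ h3
  rw [h2, Finset.mul_sum]
  exact Finset.sum_le_sum fun i _ =>
    mul_le_mul_of_nonneg_right (hH.eigenvalues_pow_le k i) (hc i)

lemma re_trace_vecMulVec_mul_pow_nonneg {H : Matrix n n ℂ} (hH : H.IsHermitian) (v : n → ℂ)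
    (k : ℕ) : 0 ≤ (vecMulVec v (star v) * H ^ (2 * k)).trace.re := by
  obtain ⟨c, hc, hcs⟩ := hH.exists_pow_eq_sum v
  rw [vecMulVec_mul, trace_vecMulVec, dotProduct_comm, ← dotProduct_mulVec, hcs,
    Complex.ofReal_re]
  exact Finset.sum_nonneg fun i _ => mul_nonneg ((even_two_mul k).pow_nonneg _) (hc i)

/-- The effect of a rank one perturbation on an odd moment of a Hermitian matrix. -/
lemma re_trace_vecMulVec_mul_pow_sub_le {H K : Matrix n n ℂ} (hH : H.IsHermitian)
    (hK : K.IsHermitian) (v : n → ℂ) (hv : star v ⬝ᵥ v = 1)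
    (hHK : H = K + vecMulVec v (star v)) (k : ℕ) :
    (vecMulVec v (star v) * H ^ (2 * k + 1)).trace.re -
      (vecMulVec v (star v) * K ^ (2 * k + 1)).trace.re ≤
      (2 * k + 1) / 2 * (vecMulVec v (star v) * H ^ (2 * k)).trace.re +
        (2 * k + 1) / 2 * (vecMulVec v (star v) * K ^ (2 * k)).trace.re := by
  obtain ⟨c, hc, hcs⟩ := hH.exists_pow_eq_sum v
  obtain ⟨d, hd, hds⟩ := hK.exists_pow_eq_sum v
  have hc1 : ∑ i, c i = 1 := by
    have := hcs 0
    simp only [pow_zero, one_mulVec, hv, one_mul] at this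
    exact_mod_cast this.symm
  have hd1 : ∑ i, d i = 1 := by
    have := hds 0
    simp only [pow_zero, one_mulVec, hv, one_mul] at this
    exact_mod_cast this.symm
  -- Telescoping: the rank-one middle factor splits each term into ⟨v, H^j v⟩ ⟨v, K^(2k-j) v⟩. The
  -- scalar inequality is then integrated against the product of the two spectral measures, which
  -- are probability measures.
  rw [← Complex.sub_re, ← trace_sub, ← mul_sub, pow_sub_pow_eq_sum,
    show H - K = vecMulVec v (star v) by rw [hHK]; abel, Finset.mul_sum, trace_sum,
    Complex.re_sum]
  simp only [trace_vecMulVec_star_mul_mul]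
  simp only [trace_vecMulVec_star_mul, hcs, hds,
    ← Complex.ofReal_mul, Complex.ofReal_re, Nat.add_sub_cancel]
  set x := hH.eigenvalues
  set y := hK.eigenvalues
  have h1 : ∑ j ∈ Finset.range (2 * k + 1),
      (∑ i, x i ^ j * c i) * (∑ l, y l ^ (2 * k - j) * d l) =
      ∑ i, ∑ l, c i * d l * ∑ j ∈ Finset.range (2 * k + 1), x i ^ j * y l ^ (2 * k - j) := by
    simp_rw [Finset.sum_mul_sum]
    rw [Finset.sum_comm]
    refine Finset.sum_congr rfl fun i _ => ?_
    rw [Finset.sum_comm]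
    refine Finset.sum_congr rfl fun l _ => ?_
    rw [Finset.mul_sum]
    refine Finset.sum_congr rfl fun j _ => ?_
    ring
  have h2 : (2 * (k : ℝ) + 1) / 2 * (∑ i, x i ^ (2 * k) * c i) +
      (2 * k + 1) / 2 * (∑ l, y l ^ (2 * k) * d l) =
      ∑ i, ∑ l, c i * d l * ((2 * k + 1) / 2 * (x i ^ (2 * k) + y l ^ (2 * k))) := by
    have ha : ∑ i, x i ^ (2 * k) * c i = ∑ i, ∑ l, x i ^ (2 * k) * c i * d l := by
      simp only [← Finset.mul_sum, hd1, mul_one]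
    have hb : ∑ l, y l ^ (2 * k) * d l = ∑ i, ∑ l, c i * (y l ^ (2 * k) * d l) := by
      simp only [← Finset.mul_sum, ← Finset.sum_mul, hc1, one_mul]
    rw [ha, hb, Finset.mul_sum, Finset.mul_sum, ← Finset.sum_add_distrib]
    refine Finset.sum_congr rfl fun i _ => ?_
    rw [Finset.mul_sum, Finset.mul_sum, ← Finset.sum_add_distrib]
    refine Finset.sum_congr rfl fun l _ => ?_
    ring
  rw [h1, h2]
  exact Finset.sum_le_sum fun i _ => Finset.sum_le_sum fun l _ =>
    mul_le_mul_of_nonneg_left (sum_pow_mul_pow_le _ _ _) (mul_nonneg (hc i) (hd l))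

end Hermitian

/-! ### Moments of random subframes of a tight frame -/

section CenteredFrame

open Matrix

variable {ι n : Type*} [DecidableEq n]

/-- The frame operator of the vectors `v i`, `i ∈ S`, minus the scalar `c`. -/
def centeredFrame (v : ι → n → ℂ) (c : ℝ) (S : Finset ι) : Matrix n n ℂ :=
  ∑ i ∈ S, vecMulVec (v i) (star (v i)) - (c : ℂ) • 1

lemma isHermitian_centeredFrame (v : ι → n → ℂ) (c : ℝ) (S : Finset ι) :
    (centeredFrame v c S).IsHermitian := by
  refine IsHermitian.sub ?_ ?_
  · rw [IsHermitian, conjTranspose_sum]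
    refine Finset.sum_congr rfl fun i _ => ?_
    rw [conjTranspose_vecMulVec, star_star]
  · rw [IsHermitian, conjTranspose_smul, conjTranspose_one]
    simp

variable [Fintype ι]

lemma re_trace_sum_smul_mul [Fintype n] (A : ι → Matrix n n ℂ) (r : ι → ℝ) (X : Matrix n n ℂ) :
    ((∑ i, (r i : ℂ) • A i) * X).trace.re = ∑ i, r i * (A i * X).trace.re := by
  rw [Finset.sum_mul, trace_sum, Complex.re_sum]
  refine Finset.sum_congr rfl fun i _ => ?_
  rw [smul_mul_assoc, trace_smul, smul_eq_mul, Complex.re_ofReal_mul]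

variable [DecidableEq ι]

/-- With `c = p * D`, taking `q = -p` gives the centred operator itself and `q = p` gives it plus
2pD; both occur in the recursion. -/
lemma sum_ite_add_smul_eq_centeredFrame {v : ι → n → ℂ} {D : ℝ}
    (hD : ∑ i, vecMulVec (v i) (star (v i)) = (D : ℂ) • 1) (c q : ℝ) (S : Finset ι) :
    ∑ i, (((if i ∈ S then 1 else 0) + q : ℝ) : ℂ) • vecMulVec (v i) (star (v i)) =
      centeredFrame v c S + ((c + q * D : ℝ) : ℂ) • 1 := by
  have h : ∀ i, (((if i ∈ S then 1 else 0) + q : ℝ) : ℂ) • vecMulVec (v i) (star (v i)) =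
      (if i ∈ S then vecMulVec (v i) (star (v i)) else 0) +
        (q : ℂ) • vecMulVec (v i) (star (v i)) := fun i => by
    split_ifs <;> simp [add_smul]
  rw [Finset.sum_congr rfl fun i _ => h i, Finset.sum_add_distrib, ← Finset.smul_sum, hD,
    Finset.sum_ite_mem, Finset.univ_inter, centeredFrame, smul_smul]
  push_cast
  rw [add_smul]
  abel

variable [Fintype n] {v : ι → n → ℂ} {D p : ℝ}

/-- One step of the moment recursion for a random subframe of a tight frame. -/
lemma sum_bernoulliWeight_re_trace_pow_succ_le (hv : ∀ i, star (v i) ⬝ᵥ v i = 1)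
    (hD : ∑ i, vecMulVec (v i) (star (v i)) = (D : ℂ) • 1) (hp0 : 0 ≤ p) (hp1 : p ≤ 1) (k : ℕ) :
    ∑ S, bernoulliWeight p S * (centeredFrame v (p * D) S ^ (2 * (k + 1))).trace.re ≤
      ∑ S, bernoulliWeight p S * ((2 * k + 1) / 2 *
        ((centeredFrame v (p * D) S ^ (2 * k + 1)).trace.re +
          2 * (p * D) * (centeredFrame v (p * D) S ^ (2 * k)).trace.re)) := by
  set H := centeredFrame v (p * D)
  have h1 : ∀ S, (H S ^ (2 * (k + 1))).trace.re =
      ∑ i, ((if i ∈ S then 1 else 0) - p) *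
        (vecMulVec (v i) (star (v i)) * H S ^ (2 * k + 1)).trace.re := fun S => by
    rw [← re_trace_sum_smul_mul]
    simp only [sub_eq_add_neg]
    rw [sum_ite_add_smul_eq_centeredFrame hD (p * D), show 2 * (k + 1) = 2 * k + 1 + 1 by ring,
      pow_succ']
    simp [H]
  have h2 : ∀ S, ((2 * k + 1) / 2 * ((H S ^ (2 * k + 1)).trace.re +
          2 * (p * D) * (H S ^ (2 * k)).trace.re)) =
      ∑ i, ((if i ∈ S then 1 else 0) + p) * ((2 * k + 1) / 2 *
        (vecMulVec (v i) (star (v i)) * H S ^ (2 * k)).trace.re) := fun S => by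
    have h : ∑ i, ((if i ∈ S then 1 else 0) + p) *
        (vecMulVec (v i) (star (v i)) * H S ^ (2 * k)).trace.re =
        (H S ^ (2 * k + 1)).trace.re + 2 * (p * D) * (H S ^ (2 * k)).trace.re := by
      rw [← re_trace_sum_smul_mul, sum_ite_add_smul_eq_centeredFrame hD (p * D), add_mul,
        ← pow_succ', trace_add, Complex.add_re, smul_mul_assoc, one_mul, trace_smul, smul_eq_mul,
        Complex.re_ofReal_mul]
      ring
    rw [← h, Finset.mul_sum]
    exact Finset.sum_congr rfl fun i _ => by ring
  simp only [h1, h2, Finset.mul_sum (s := Finset.univ (α := ι))]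
  rw [Finset.sum_comm, Finset.sum_comm (f := fun S i => bernoulliWeight p S *
    (((if i ∈ S then 1 else 0) + p) * ((2 * k + 1) / 2 *
      (vecMulVec (v i) (star (v i)) * H S ^ (2 * k)).trace.re)))]
  refine Finset.sum_le_sum fun i _ => sum_bernoulliWeight_sub_mul_le hp0 hp1 i
    (fun S => (vecMulVec (v i) (star (v i)) * H S ^ (2 * k + 1)).trace.re)
    (fun S => (2 * k + 1) / 2 * (vecMulVec (v i) (star (v i)) * H S ^ (2 * k)).trace.re)
    (fun S hS => ?_) (fun S => ?_)
  · refine re_trace_vecMulVec_mul_pow_sub_le (isHermitian_centeredFrame _ _ _)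
      (isHermitian_centeredFrame _ _ _) (v i) (hv i) ?_ k
    dsimp only [H, centeredFrame]
    rw [Finset.sum_insert hS]
    abel
  · exact mul_nonneg (by positivity)
      (re_trace_vecMulVec_mul_pow_nonneg (isHermitian_centeredFrame _ _ _) _ _)

/-- Young's inequality for each eigenvalue x: x^(2k) (x - r)² ≥ 0. It removes the odd moment from
the recursion. -/
lemma Matrix.IsHermitian.mul_re_trace_pow_le {H : Matrix n n ℂ} (hH : H.IsHermitian) (k : ℕ)
    (r : ℝ) : r * (H ^ (2 * k + 1)).trace.re ≤
      1 / 2 * (H ^ (2 * (k + 1))).trace.re + r ^ 2 / 2 * (H ^ (2 * k)).trace.re := by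
  simp only [hH.re_trace_pow, Finset.mul_sum, ← Finset.sum_add_distrib]
  refine Finset.sum_le_sum fun i _ => ?_
  set x := hH.eigenvalues i
  have h := mul_nonneg ((even_two_mul k).pow_nonneg x) (sq_nonneg (x - r))
  have h1 : x ^ (2 * (k + 1)) = x ^ (2 * k) * x ^ 2 := by ring
  have h2 : x ^ (2 * k + 1) = x ^ (2 * k) * x := by ring
  rw [h1, h2]
  nlinarith

lemma sum_bernoulliWeight_re_trace_pow_succ_le' (hv : ∀ i, star (v i) ⬝ᵥ v i = 1)
    (hD : ∑ i, vecMulVec (v i) (star (v i)) = (D : ℂ) • 1) (hp0 : 0 ≤ p) (hp1 : p ≤ 1)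
    (hpD : 1 ≤ p * D) (k : ℕ) :
    ∑ S, bernoulliWeight p S * (centeredFrame v (p * D) S ^ (2 * (k + 1))).trace.re ≤
      3 * (2 * k + 1) ^ 2 * (p * D) *
        ∑ S, bernoulliWeight p S * (centeredFrame v (p * D) S ^ (2 * k)).trace.re := by
  have h := sum_bernoulliWeight_re_trace_pow_succ_le hv hD hp0 hp1 k
  set H := centeredFrame v (p * D)
  have h1 : ∑ S, bernoulliWeight p S * ((2 * k + 1) / 2 *
        ((H S ^ (2 * k + 1)).trace.re + 2 * (p * D) * (H S ^ (2 * k)).trace.re)) ≤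
      ∑ S, bernoulliWeight p S * (1 / 2 * (H S ^ (2 * (k + 1))).trace.re +
        3 / 2 * (2 * k + 1) ^ 2 * (p * D) * (H S ^ (2 * k)).trace.re) := by
    refine Finset.sum_le_sum fun S _ =>
      mul_le_mul_of_nonneg_left ?_ (bernoulliWeight_nonneg hp0 hp1 S)
    have hH := isHermitian_centeredFrame v (p * D) S
    have h2 := hH.mul_re_trace_pow_le k ((2 * k + 1) / 2)
    have h3 := hH.re_trace_pow_nonneg k
    have hk : (0 : ℝ) ≤ k := k.cast_nonneg
    -- Here `1 ≤ p * D` makes the two coefficients of the moment of order 2k comparable. Absorbing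
    -- half of the left side later turns 3/2 into 3.
    have h4 : ((2 * k + 1) / 2) ^ 2 / 2 + (2 * k + 1) * (p * D) ≤
        3 / 2 * (2 * (k : ℝ) + 1) ^ 2 * (p * D) := by
      have ha : (2 * (k : ℝ) + 1) ≤ (2 * k + 1) ^ 2 := by nlinarith
      have hb := mul_le_mul_of_nonneg_right ha (zero_le_one.trans hpD)
      have hc := mul_le_mul_of_nonneg_left hpD (sq_nonneg (2 * (k : ℝ) + 1))
      nlinarith
    have h5 := mul_le_mul_of_nonneg_right h4 h3
    simp only [H]
    linarith
  have h6 : ∀ (a : ℝ) (f : Finset ι → ℝ), ∑ S, bernoulliWeight p S * (a * f S) =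
      a * ∑ S, bernoulliWeight p S * f S := fun a f => by
    rw [Finset.mul_sum]
    exact Finset.sum_congr rfl fun S _ => by ring
  have h7 := h.trans h1
  simp only [mul_add (bernoulliWeight p _), Finset.sum_add_distrib] at h7
  rw [h6, h6] at h7
  linarith

/-- The moments of a random subframe of a tight frame. -/
lemma sum_bernoulliWeight_re_trace_pow_le (hv : ∀ i, star (v i) ⬝ᵥ v i = 1)
    (hD : ∑ i, vecMulVec (v i) (star (v i)) = (D : ℂ) • 1) (hp0 : 0 ≤ p) (hp1 : p ≤ 1)
    (hpD : 1 ≤ p * D) (k : ℕ) :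
    ∑ S, bernoulliWeight p S * (centeredFrame v (p * D) S ^ (2 * k)).trace.re ≤
      (∏ j ∈ Finset.range k, 3 * (2 * (j : ℝ) + 1) ^ 2) * Fintype.card n * (p * D) ^ k := by
  induction k with
  | zero => simp [← Finset.sum_mul, sum_bernoulliWeight]
  | succ k ih =>
    refine (sum_bernoulliWeight_re_trace_pow_succ_le' hv hD hp0 hp1 hpD k).trans ?_
    refine (mul_le_mul_of_nonneg_left ih (by positivity)).trans_eq ?_
    rw [Finset.prod_range_succ]
    ring

end CenteredFrame

/-! ### Gabor systems and their singular values -/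

section Gabor

open Matrix

variable {M : ℕ} [NeZero M]

lemma timeFreqShift_apply (p : ZMod M × ZMod M) (g : ZMod M → ℂ) (j : ZMod M) :
    timeFreqShift p g j = ZMod.stdAddChar (p.2 * j) * g (j - p.1) := rfl

lemma star_timeFreqShift_apply (p : ZMod M × ZMod M) (g : ZMod M → ℂ) (j : ZMod M) :
    star (timeFreqShift p g) j = ZMod.stdAddChar (-(p.2 * j)) * star (g (j - p.1)) := by
  rw [Pi.star_apply, timeFreqShift_apply, star_mul', AddChar.map_neg_eq_conj]
  rfl

lemma star_timeFreqShift_dotProduct {g : ZMod M → ℂ} (hg : star g ⬝ᵥ g = 1)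
    (p : ZMod M × ZMod M) : star (timeFreqShift p g) ⬝ᵥ timeFreqShift p g = 1 := by
  rw [← hg]
  simp only [dotProduct]
  rw [← (Equiv.subRight p.1).sum_comp fun j => star g j * g j]
  refine Finset.sum_congr rfl fun j _ => ?_
  rw [star_timeFreqShift_apply, timeFreqShift_apply, mul_mul_mul_comm, ← AddChar.map_add_eq_mul,
    neg_add_cancel, AddChar.map_zero_eq_one, one_mul]
  rfl

/-- The full Gabor system is a tight frame. -/
lemma sum_vecMulVec_timeFreqShift {g : ZMod M → ℂ} (hg : star g ⬝ᵥ g = 1) :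
    ∑ p : ZMod M × ZMod M, vecMulVec (timeFreqShift p g) (star (timeFreqShift p g)) =
      ((M : ℝ) : ℂ) • (1 : Matrix (ZMod M) (ZMod M) ℂ) := by
  ext i j
  rw [Matrix.sum_apply, Fintype.sum_prod_type]
  have h : ∀ k l : ZMod M,
      vecMulVec (timeFreqShift (k, l) g) (star (timeFreqShift (k, l) g)) i j =
      ZMod.stdAddChar (l * (i - j)) * (g (i - k) * star (g (j - k))) := fun k l => by
    rw [vecMulVec_apply, star_timeFreqShift_apply, timeFreqShift_apply, mul_mul_mul_comm,
      ← AddChar.map_add_eq_mul, ← sub_eq_add_neg, mul_sub]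
  -- Orthogonality of characters in the modulation variable kills the off-diagonal entries;
  -- translations then sum to the norm of `g`.
  simp only [h, ← Finset.sum_mul, AddChar.sum_mulShift _ (ZMod.isPrimitive_stdAddChar M),
    sub_eq_zero, ZMod.card]
  rcases eq_or_ne i j with rfl | hij
  · rw [← Finset.mul_sum]
    have h1 : ∑ k, g (i - k) * star (g (i - k)) = 1 := by
      rw [← hg, dotProduct, ← (Equiv.subLeft i).sum_comp fun j => star g j * g j]
      exact Finset.sum_congr rfl fun j _ => mul_comm _ _
    rw [h1]
    simp
  · simp [hij]

/-- The centered frame operator of the Gabor system `(g, S)`. -/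
noncomputable def gaborDeviation (g : ZMod M → ℂ) (c : ℝ) (S : Finset (ZMod M × ZMod M)) :
    Matrix (ZMod M) (ZMod M) ℂ :=
  centeredFrame (fun p => timeFreqShift p g) c S

lemma isHermitian_gaborDeviation (g : ZMod M → ℂ) (c : ℝ) (S : Finset (ZMod M × ZMod M)) :
    (gaborDeviation g c S).IsHermitian :=
  isHermitian_centeredFrame _ _ _

lemma gaborSynthesis_mul_gaborAnalysis (g : ZMod M → ℂ) (c : ℝ)
    (S : Finset (ZMod M × ZMod M)) :
    gaborSynthesis g S * gaborAnalysis g S = gaborDeviation g c S + (c : ℂ) • 1 := by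
  rw [gaborDeviation, centeredFrame, sub_add_cancel, ← Finset.sum_coe_sort]
  ext i j
  rw [Matrix.sum_apply]
  simp [gaborAnalysis, gaborSynthesis, mul_apply, vecMulVec_apply]

lemma trace_gaborDeviation {g : ZMod M → ℂ} (hg : star g ⬝ᵥ g = 1) (c : ℝ)
    (S : Finset (ZMod M × ZMod M)) : (gaborDeviation g c S).trace.re = S.card - c * M := by
  rw [gaborDeviation, centeredFrame, trace_sub, trace_sum]
  have h : ∀ p ∈ S, (vecMulVec (timeFreqShift p g) (star (timeFreqShift p g))).trace = 1 :=
    fun p _ => by rw [trace_vecMulVec, dotProduct_comm, star_timeFreqShift_dotProduct hg]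
  rw [Finset.sum_congr rfl h]
  simp [trace_one, ZMod.card]

lemma sq_singularValues_gaborAnalysis_sub_pow_le (g : ZMod M → ℂ) (c : ℝ)
    (S : Finset (ZMod M × ZMod M)) (k : ℕ) {i : ℕ} (hi : i < M) :
    ((toEuclideanLin (gaborAnalysis g S)).singularValues i ^ 2 - c) ^ (2 * k) ≤
      (gaborDeviation g c S ^ (2 * k)).trace.re := by
  set T := toEuclideanLin (gaborAnalysis g S)
  have hi' : i < Module.finrank ℂ (EuclideanSpace ℂ (ZMod M)) := by
    rwa [finrank_euclideanSpace, ZMod.card]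
  obtain ⟨w, hw⟩ := (T.hasEigenvalue_adjoint_comp_self_sq_singularValues hi').exists_hasEigenvector
  have hw1 := hw.apply_eq_smul
  have hw0 : w.ofLp ≠ 0 := fun h => hw.2 (by ext j; simp [h])
  refine (isHermitian_gaborDeviation g c S).pow_le_re_trace_of_mulVec_eq k hw0 ?_
  have h1 : (gaborSynthesis g S * gaborAnalysis g S) *ᵥ w.ofLp =
      ((T.singularValues i ^ 2 : ℝ) : ℂ) • w.ofLp := by
    have h2 := congrArg WithLp.ofLp hw1
    rw [LinearMap.comp_apply, ← toEuclideanLin_conjTranspose_eq_adjoint, gaborAnalysis,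
      conjTranspose_conjTranspose] at h2
    simpa [T, toLpLin_apply, gaborAnalysis] using h2
  rw [gaborSynthesis_mul_gaborAnalysis g c, add_mulVec, smul_mulVec, one_mulVec] at h1
  rw [Complex.ofReal_sub, sub_smul, ← h1, add_sub_cancel_right]

/-- A Gabor system with a small even moment of the centered frame operator is well conditioned. -/
lemma wellConditioned_of_re_trace_le {g : ZMod M → ℂ} (hg : star g ⬝ᵥ g = 1) {c δ : ℝ}
    (hc : 0 ≤ c) (hδ : 0 < δ) (S : Finset (ZMod M × ZMod M)) {k : ℕ} (hk : k ≠ 0)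
    (h : (gaborDeviation g c S ^ (2 * k)).trace.re ≤ (δ / (2 + δ) * c) ^ (2 * k)) :
    (S.card : ℝ) / M * (1 - δ) ≤ sigmaMin (gaborAnalysis g S) ^ 2 ∧
      sigmaMin (gaborAnalysis g S) ^ 2 ≤ sigmaMax (gaborAnalysis g S) ^ 2 ∧
      sigmaMax (gaborAnalysis g S) ^ 2 ≤ (S.card : ℝ) / M * (1 + δ) := by
  have hM : 0 < M := Nat.pos_of_ne_zero (NeZero.ne M)
  have hM' : (0 : ℝ) < M := Nat.cast_pos.2 hM
  -- This `t` solves c + t = (1 + δ)(c - t), the worst case of the upper bound when σ² and |S|/M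
  -- both deviate from `c` by at most `t`.
  set t := δ / (2 + δ) * c with ht
  have ht0 : 0 ≤ t := by positivity
  have htc : t * (2 + δ) = δ * c := by rw [ht]; field_simp
  have hs : ∀ i < M, |(toEuclideanLin (gaborAnalysis g S)).singularValues i ^ 2 - c| ≤ t :=
    fun i hi => by
      refine le_of_pow_le_pow_left₀ (n := 2 * k) (by omega) ht0 ?_
      rw [(even_two_mul k).pow_abs]
      exact (sq_singularValues_gaborAnalysis_sub_pow_le g c S k hi).trans h
  -- The trace of the deviation is |S| - cM, so the same moment controls the cardinality and no
  -- separate concentration bound is needed.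
  have htr := (isHermitian_gaborDeviation g c S).abs_re_trace_le hk ht0 h
  rw [trace_gaborDeviation hg, ZMod.card] at htr
  have hS : |(S.card : ℝ) / M - c| ≤ t := by
    rw [show (S.card : ℝ) / M - c = (S.card - c * M) / M by field_simp, abs_div,
      abs_of_pos hM', div_le_iff₀ hM', mul_comm t]
    exact htr
  have hmin : |sigmaMin (gaborAnalysis g S) ^ 2 - c| ≤ t := by
    rw [sigmaMin, ZMod.card]
    exact hs _ (by omega)
  have hmax : |sigmaMax (gaborAnalysis g S) ^ 2 - c| ≤ t := hs 0 hM
  rw [abs_le] at hS hmin hmax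
  refine ⟨?_, ?_, ?_⟩
  · have h0 : (0 : ℝ) ≤ (S.card : ℝ) / M := by positivity
    nlinarith [mul_nonneg hδ.le ht0]
  · refine pow_le_pow_left₀ (LinearMap.singularValues_nonneg _ _) ?_ 2
    exact (toEuclideanLin (gaborAnalysis g S)).singularValues_antitone (Nat.zero_le _)
  · nlinarith [mul_nonneg hδ.le ht0]

lemma measurable_re_trace_gaborDeviation_pow (c : ℝ) (S : Finset (ZMod M × ZMod M)) (k : ℕ) :
    Measurable fun g : ZMod M → ℂ => (gaborDeviation g c S ^ k).trace.re := by
  have h : Continuous fun g : ZMod M → ℂ => gaborDeviation g c S := by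
    unfold gaborDeviation centeredFrame
    refine Continuous.sub (continuous_finsetSum _ fun p _ => ?_) continuous_const
    have h1 : Continuous fun g : ZMod M → ℂ => timeFreqShift p g :=
      continuous_pi fun j => by
        simp only [timeFreqShift_apply]
        fun_prop
    exact h1.matrix_vecMulVec h1.star
  exact (Complex.continuous_re.comp (h.pow k).matrix_trace).measurable

end Gabor

/-! ### Steinhaus windows -/

section Steinhaus

open Matrix

variable {M : ℕ} {Ω : Type*} [MeasurableSpace Ω] {P : Measure Ω}
  {g : Ω → ZMod M → ℂ}

lemma IsSteinhaus.measurable (hg : IsSteinhaus g P) : Measurable g := by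
  obtain ⟨y, hy, -, -, h⟩ := hg
  refine measurable_pi_lambda _ fun j => ?_
  simp only [h]
  have := hy j
  fun_prop

lemma IsSteinhaus.star_dotProduct [NeZero M] (hg : IsSteinhaus g P) (ω : Ω) :
    star (g ω) ⬝ᵥ g ω = 1 := by
  obtain ⟨y, -, -, -, h⟩ := hg
  have hM : (0 : ℝ) < M := Nat.cast_pos.2 (Nat.pos_of_ne_zero (NeZero.ne M))
  have h1 : ∀ j, star (g ω j) * g ω j = ((1 / M : ℝ) : ℂ) := fun j => by
    rw [Complex.star_def, ← Complex.normSq_eq_conj_mul_self, h, Complex.normSq_mul,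
      Complex.normSq_ofReal, Complex.normSq_eq_norm_sq, Complex.norm_exp]
    have : (2 * (Real.pi : ℂ) * Complex.I * (y j ω : ℂ)).re = 0 := by simp
    rw [this, Real.exp_zero, one_pow, mul_one, div_mul_div_comm, one_mul, Real.mul_self_sqrt hM.le]
  simp only [dotProduct, Pi.star_apply, h1]
  rw [Finset.sum_const, Finset.card_univ, ZMod.card, nsmul_eq_mul]
  rw [← Complex.ofReal_natCast, ← Complex.ofReal_mul, mul_one_div_cancel hM.ne',
    Complex.ofReal_one]

end Steinhaus

/-! ### The law of a Bernoulli subset -/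

section BernoulliSubset

variable {ι Ω : Type*} [DecidableEq ι] {L : Ω → Finset ι}

lemma setOf_finset_eq_iInter (L : Ω → Finset ι) (S : Finset ι) :
    {ω | L ω = S} = ⋂ i, if i ∈ S then {ω | i ∈ L ω} else {ω | i ∈ L ω}ᶜ := by
  ext ω
  simp only [Set.mem_ofPred_eq, Set.mem_iInter, Finset.ext_iff]
  refine forall_congr' fun i => ?_
  split_ifs with h <;> simp [h]

variable [Fintype ι] [MeasurableSpace Ω] {P : Measure Ω} {t : ℝ}

lemma IsBernoulliSubset.measurableSet_eq (hL : IsBernoulliSubset L P t) (S : Finset ι) :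
    MeasurableSet {ω | L ω = S} := by
  rw [setOf_finset_eq_iInter]
  refine MeasurableSet.iInter fun i => ?_
  split_ifs
  exacts [hL.1 i, (hL.1 i).compl]

lemma IsBernoulliSubset.measureReal_eq [IsProbabilityMeasure P] (hL : IsBernoulliSubset L P t)
    (S : Finset ι) : P.real {ω | L ω = S} = bernoulliWeight t S := by
  have h := hL.2.1
  rw [iIndepSet_iff_iIndep] at h
  rw [setOf_finset_eq_iInter, Measure.real, h.meas_iInter, ENNReal.toReal_prod,
    bernoulliWeight]
  · refine Finset.prod_congr rfl fun i _ => ?_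
    split_ifs
    · exact hL.2.2 i
    · rw [← hL.2.2 i]
      exact probReal_compl_eq_one_sub (hL.1 i)
  · intro i
    have h1 := MeasurableSpace.measurableSet_generateFrom (Set.mem_singleton {ω | i ∈ L ω})
    split_ifs
    exacts [h1, h1.compl]

lemma IsBernoulliSubset.measureReal_mem [IsProbabilityMeasure P] (hL : IsBernoulliSubset L P t)
    (F : Finset (Finset ι)) : P.real {ω | L ω ∈ F} = ∑ S ∈ F, bernoulliWeight t S := by
  have h : {ω | L ω ∈ F} = ⋃ S ∈ F, {ω | L ω = S} := by ext; simp
  rw [h, measureReal_biUnion_finset]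
  · exact Finset.sum_congr rfl fun S _ => hL.measureReal_eq S
  · intro S _ T _ hST
    exact Set.disjoint_left.2 fun ω h1 h2 => hST (Eq.trans (Eq.symm h1) h2)
  · exact fun S _ => hL.measurableSet_eq S

end BernoulliSubset

/-! ### From moments to nested probabilities -/

/-- Markov's inequality on the product space: the moment is averaged over `s` for each `ω`, and the
exchange of sum and integral yields the average over `s` of the probabilities in `ω`. -/
lemma sum_mul_measureReal_le {σ Ω : Type*} [Fintype σ] [MeasurableSpace Ω] {P : Measure Ω}
    [IsProbabilityMeasure P] (w : σ → ℝ) (hw : ∀ s, 0 ≤ w s) {Z : σ → Ω → ℝ}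
    (hZ : ∀ s, Measurable (Z s)) (hZ0 : ∀ s ω, 0 ≤ Z s ω) {t B : ℝ} (ht : 0 < t)
    (hB : ∀ ω, ∑ s, w s * Z s ω ≤ B) :
    ∑ s, w s * P.real {ω | t < Z s ω} ≤ B / t := by
  have hm : ∀ s, MeasurableSet {ω | t < Z s ω} := fun s => measurableSet_lt measurable_const (hZ s)
  have h1 : ∑ s, w s * P.real {ω | t < Z s ω} =
      ∫ ω, ∑ s, w s * ({ω | t < Z s ω}.indicator 1 ω) ∂P := by
    rw [integral_finsetSum]
    · refine Finset.sum_congr rfl fun s _ => ?_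
      rw [integral_const_mul, integral_indicator_one (hm s)]
    · exact fun s _ => ((integrable_const (1 : ℝ)).indicator (hm s)).const_mul _
  rw [h1]
  have h2 : ∫ ω, ∑ s, w s * ({ω | t < Z s ω}.indicator 1 ω) ∂P ≤ ∫ _ω, B / t ∂P := by
    refine integral_mono (integrable_finsetSum _ fun s _ =>
      ((integrable_const (1 : ℝ)).indicator (hm s)).const_mul _) (integrable_const _) fun ω => ?_
    refine le_trans ?_ (div_le_div_of_nonneg_right (hB ω) ht.le)
    rw [Finset.sum_div]
    refine Finset.sum_le_sum fun s _ => ?_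
    rw [mul_div_assoc]
    refine mul_le_mul_of_nonneg_left ?_ (hw s)
    by_cases h : t < Z s ω
    · rw [Set.indicator_of_mem (by exact h), Pi.one_apply, one_le_div ht]
      exact h.le
    · rw [Set.indicator_of_notMem (by exact h)]
      exact div_nonneg (hZ0 s ω) ht.le
  simpa using h2

/-- The probability bound for a random Gabor system, in terms of the expected redundancy
`t * M`. -/
lemma wellConditioned_probability_bound {M : ℕ} [NeZero M] {t δ ε : ℝ} (hδ : 0 < δ) (hε : 0 < ε)
    (htM : 1 ≤ t * M) {k : ℕ} (hk : k ≠ 0)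
    {Ω₁ : Type*} [MeasurableSpace Ω₁] {P₁ : Measure Ω₁} [IsProbabilityMeasure P₁]
    {L : Ω₁ → Finset (ZMod M × ZMod M)} (hL : IsBernoulliSubset L P₁ t)
    {Ω₂ : Type*} [MeasurableSpace Ω₂] {P₂ : Measure Ω₂} [IsProbabilityMeasure P₂]
    {g : Ω₂ → ZMod M → ℂ} (hg : IsSteinhaus g P₂) :
    1 - (∏ j ∈ Finset.range k, 3 * (2 * (j : ℝ) + 1) ^ 2) * M * (t * M) ^ k /
        (δ / (2 + δ) * (t * M)) ^ (2 * k) / ε ≤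
      P₁.real {ω | 1 - ε ≤ P₂.real (wellConditionedEvent g (L ω) δ)} := by
  have ht0 : 0 ≤ t := hL.2.2 0 ▸ measureReal_nonneg
  have ht1 : t ≤ 1 := hL.2.2 0 ▸ measureReal_le_one
  have hw := bernoulliWeight_nonneg (ι := ZMod M × ZMod M) ht0 ht1
  set θ := (δ / (2 + δ) * (t * M)) ^ (2 * k) with hθ
  have hθ0 : 0 < θ := by positivity
  set B := (∏ j ∈ Finset.range k, 3 * (2 * (j : ℝ) + 1) ^ 2) * M * (t * M) ^ k
  set Z : Finset (ZMod M × ZMod M) → Ω₂ → ℝ := fun S ω =>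
    (gaborDeviation (g ω) (t * M) S ^ (2 * k)).trace.re
  have hZ : ∀ S, Measurable (Z S) := fun S =>
    (measurable_re_trace_gaborDeviation_pow _ S _).comp hg.measurable
  set q : Finset (ZMod M × ZMod M) → ℝ := fun S => P₂.real {ω | θ < Z S ω}
  have hq : ∑ S, bernoulliWeight t S * q S ≤ B / θ := by
    refine sum_mul_measureReal_le _ hw hZ
      (fun S ω => (isHermitian_gaborDeviation _ _ _).re_trace_pow_nonneg _) hθ0 fun ω => ?_
    have h := sum_bernoulliWeight_re_trace_pow_le
      (star_timeFreqShift_dotProduct (hg.star_dotProduct ω))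
      (sum_vecMulVec_timeFreqShift (hg.star_dotProduct ω)) ht0 ht1 htM k
    rwa [ZMod.card] at h
  have hgood : ∀ S, q S ≤ ε → 1 - ε ≤ P₂.real (wellConditionedEvent g S δ) := fun S hS => by
    have h1 : {ω | θ < Z S ω}ᶜ ⊆ wellConditionedEvent g S δ := fun ω hω =>
      wellConditioned_of_re_trace_le (hg.star_dotProduct ω) (zero_le_one.trans htM) hδ S hk
        (not_lt.1 hω)
    have h2 := probReal_compl_eq_one_sub (μ := P₂) (measurableSet_lt measurable_const (hZ S) :
      MeasurableSet {ω | θ < Z S ω})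
    have h3 := measureReal_mono (μ := P₂) h1
    linarith
  have hsub : {ω | L ω ∈ Finset.univ.filter fun S => q S ≤ ε} ⊆
      {ω | 1 - ε ≤ P₂.real (wellConditionedEvent g (L ω) δ)} := fun ω hω =>
    hgood _ (Finset.mem_filter.1 hω).2
  refine le_trans ?_ (measureReal_mono hsub)
  rw [hL.measureReal_mem]
  have hsplit := Finset.sum_filter_add_sum_filter_not (Finset.univ)
    (fun S => q S ≤ ε) (bernoulliWeight (ι := ZMod M × ZMod M) t)
  rw [sum_bernoulliWeight] at hsplit
  -- Second use of Markov's inequality, now for `q` as a function of the random subset.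
  have hbad : ∑ S with ¬ q S ≤ ε, bernoulliWeight t S ≤ B / θ / ε := by
    rw [le_div_iff₀ hε, Finset.sum_mul]
    refine le_trans ?_ hq
    refine le_trans (Finset.sum_le_sum fun S hS => mul_le_mul_of_nonneg_left
      (not_le.1 (Finset.mem_filter.1 hS).2).le (hw S)) ?_
    exact Finset.sum_le_sum_of_subset_of_nonneg (Finset.filter_subset _ _)
      fun S _ _ => mul_nonneg (hw S) measureReal_nonneg
  linarith

/-! ### Choice of parameters -/

lemma rpow_inv_le_inclusionProb_mul {m M : ℕ} (hm : 0 < m) {C : ℝ} (hC : 1 ≤ C) (hM : 3 ≤ M) :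
    (M : ℝ) ^ ((m : ℝ)⁻¹) ≤ inclusionProb m M C * M := by
  have hM0 : (0 : ℝ) < M := by positivity
  have hlog : 1 ≤ Real.log M := by
    rw [Real.le_log_iff_exp_le hM0]
    have h3 : (3 : ℝ) ≤ M := by exact_mod_cast hM
    linarith [Real.exp_one_lt_d9]
  have hm' : (m : ℝ) ≠ 0 := by positivity
  have h1 : (M : ℝ) = M ^ (((m : ℝ) - 1) / m) * (M : ℝ) ^ ((m : ℝ)⁻¹) := by
    rw [← Real.rpow_add hM0]
    have : ((m : ℝ) - 1) / m + (m : ℝ)⁻¹ = 1 := by field_simp; ring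
    rw [this, Real.rpow_one]
  have h2 : (0 : ℝ) < (M : ℝ) ^ (((m : ℝ) - 1) / m) := Real.rpow_pos_of_pos hM0 _
  have h3 : (0 : ℝ) ≤ (M : ℝ) ^ ((m : ℝ)⁻¹) := (Real.rpow_pos_of_pos hM0 _).le
  have h4 : inclusionProb m M C * M = C * Real.log M * (M : ℝ) ^ ((m : ℝ)⁻¹) := by
    rw [inclusionProb]
    conv_lhs => rw [show (C * Real.log M / (M : ℝ) ^ (((m : ℝ) - 1) / m) * (M : ℝ)) =
      C * Real.log M / (M : ℝ) ^ (((m : ℝ) - 1) / m) *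
        ((M : ℝ) ^ (((m : ℝ) - 1) / m) * (M : ℝ) ^ ((m : ℝ)⁻¹)) by rw [← h1]]
    field_simp
  rw [h4]
  exact le_mul_of_one_le_left h3 (one_le_mul_of_one_le_of_one_le hC hlog)

theorem mainTheorem2 (m : ℕ) (hm : Even m) (hm0 : 0 < m) :
    ∃ C₀ > (0 : ℝ), ∃ K > (0 : ℝ), ∃ a > (0 : ℝ), ∀ C : ℝ, C₀ ≤ C → ∀ δ : ℝ, 0 < δ →
      ∃ ε : ℝ, 0 < ε ∧ ε < 1 ∧ ε ≤ K / (C * δ) ^ m ∧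
        ∃ M₀ : ℕ, ∀ (M : ℕ) [NeZero M], M₀ ≤ M →
          ∀ (Ω₁ : Type*) [MeasurableSpace Ω₁] (P₁ : Measure Ω₁) [IsProbabilityMeasure P₁]
            (L : Ω₁ → Finset (ZMod M × ZMod M)),
            IsBernoulliSubset L P₁ (inclusionProb m M C) →
          ∀ (Ω₂ : Type*) [MeasurableSpace Ω₂] (P₂ : Measure Ω₂) [IsProbabilityMeasure P₂]
            (g : Ω₂ → ZMod M → ℂ), IsSteinhaus g P₂ →
            1 - (M : ℝ) ^ (-a) ≤
              P₁.real {ω | 1 - ε ≤ P₂.real (wellConditionedEvent g (L ω) δ)} := by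
  refine ⟨1, one_pos, 1, one_pos, 1, one_pos, fun C hC δ hδ => ?_⟩
  have hC0 : 0 < C := one_pos.trans_le hC
  -- The entry 1/2 only ensures ε < 1; the other gives the required bound with K = 1.
  have hε : 0 < min (1 / 2) (1 / (C * δ) ^ m) := lt_min (by norm_num) (by positivity)
  refine ⟨min (1 / 2) (1 / (C * δ) ^ m), hε, (min_le_left _ _).trans_lt (by norm_num),
    min_le_right _ _, ?_⟩
  set ε := min (1 / 2) (1 / (C * δ) ^ m)
  -- Moment order 2k with k = 3m: since μ ≥ M^(1/m), the factor μ^(-k) is at most M^(-3). One power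
  -- of M pays for the dimension and one for the constant bounded by `N`, leaving M^(-1).
  set c := ∏ j ∈ Finset.range (3 * m), 3 * (2 * (j : ℝ) + 1) ^ 2
  have hc : 0 ≤ c := Finset.prod_nonneg fun j _ => by positivity
  set η := δ / (2 + δ)
  have hη : 0 < η := by positivity
  obtain ⟨N, hN⟩ := exists_nat_ge (c / η ^ (2 * (3 * m)) / ε)
  refine ⟨max 3 N, fun M _ hM Ω₁ _ P₁ _ L hL Ω₂ _ P₂ _ g hg => ?_⟩
  have hM3 : 3 ≤ M := (le_max_left _ _).trans hM
  have hM0 : (0 : ℝ) < M := by positivity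
  have hM1 : (1 : ℝ) ≤ M := by exact_mod_cast (show 1 ≤ 3 by norm_num).trans hM3
  have hμ := rpow_inv_le_inclusionProb_mul hm0 hC hM3
  set μ := inclusionProb m M C * M
  have hμ1 : 1 ≤ μ := (Real.one_le_rpow hM1 (by positivity)).trans hμ
  have hμ0 : 0 < μ := one_pos.trans_le hμ1
  refine le_trans ?_ (wellConditioned_probability_bound hδ hε hμ1 (k := 3 * m)
    (by omega) hL hg)
  refine sub_le_sub_left ?_ _
  have hμ3 : (M : ℝ) ^ 3 ≤ μ ^ (3 * m) := by
    have h1 : (M : ℝ) ≤ μ ^ m := by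
      refine le_trans (le_of_eq ?_) (pow_le_pow_left₀ (by positivity) hμ m)
      rw [Real.rpow_inv_natCast_pow hM0.le hm0.ne']
    rw [mul_comm 3 m, pow_mul]
    exact pow_le_pow_left₀ hM0.le h1 3
  have hN' : c / η ^ (2 * (3 * m)) / ε ≤ M :=
    hN.trans (by exact_mod_cast (le_max_right _ _).trans hM)
  calc c * M * μ ^ (3 * m) / (η * μ) ^ (2 * (3 * m)) / ε
      = c / η ^ (2 * (3 * m)) / ε * (M / μ ^ (3 * m)) := by
        rw [mul_pow η μ, two_mul (3 * m), pow_add μ]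
        field_simp
    _ ≤ M * (M / M ^ 3) := by gcongr
    _ = (M : ℝ) ^ (-(1 : ℝ)) := by
        rw [Real.rpow_neg_one]
        field_simp
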